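/- Let $G$ be a countable discrete group acting transitively on a set $X$. A probability measure $\mu$ on $G$ is called non-degenerate if its support generates $G$ as a semigroup, and symmetric if $\mu(g^{-1})=\mu(g)$ for all $g\in G$. Put $p_\mu(x,y)=\sum_{g\in G,\,gx=y}\mu(g)$ for $x,y\in X$; a function $f:X\to\mathbb{R}$ is $\mu$-harmonic if $f(x)=\sum_{y\in X}f(y)\,p_\mu(x,y)$ for all $x\in X$, and the action is $\mu$-Liouville if every bounded $\mu$-harmonic function on $X$ is constant. For a finitely additive probability measure $m$ defined on all subsets of $G$ and $x\in X$, let $m\cdot x$ be the finitely additive measure on $X$ given by $(m\cdot x)(A)=m(\{g\in G: gx\in A\})$. For a finite set $E\subseteq G$ and $x\in X$, let $Ex$ be the multiset of the points $gx$, $g\in E$, counted with multiplicity, so that $$|Ex\,\Delta\, Ey|=\sum_{z\in X}\bigl|\,|\{g\in E: gx=z\}|-|\{g\in E: gy=z\}|\,\bigr|.$$ Then the following three conditions are equivalent: 1. there exists a non-degenerate symmetric probability measure $\mu$ on $G$ such that the action of $G$ on $X$ is $\mu$-Liouville; 2. there exists a finitely additive probability measure $m$ on the subsets of $G$ such that $m\cdot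 x=m\cdot y$ for all $x,y\in X$; 3. for every $\varepsilon>0$ and every finite set $F\subseteq X$ there exists a non-empty finite set $E\subseteq G$ such that $|Ex\,\Delta\, Ey|\le\varepsilon|E|$ for all $x,y\in F$. -/

import Mathlib

namespace LiouvilleAction

/-- A probability measure on the discrete group `G` is non-degenerate if its support generates
`G` as a semigroup. -/
def NonDegenerate {G : Type*} [Group G] (μ : PMF G) : Prop :=
  Subsemigroup.closure μ.support = ⊤

/-- A probability measure on `G` is symmetric if `μ(g⁻¹) = μ(g)` for all `g`. -/
def Symmetric {G : Type*} [Group G] (μ : PMF G) : Prop :=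
  ∀ g : G, μ g⁻¹ = μ g

/-- The transition probability `p_μ(x, y)`, the sum of `μ(g)` over all `g` with `g x = y`. -/
noncomputable def transProb {G X : Type*} [Group G] [MulAction G X] (μ : PMF G) (x y : X) : ℝ :=
  ∑' g : {g : G // g • x = y}, (μ (g : G)).toReal

/-- `f` is `μ`-harmonic if `f(x)` is the sum over `y` of `f(y) p_μ(x, y)`, for every `x`
(the sum being required to converge, which is automatic for bounded `f`). -/
def IsHarmonic {G X : Type*} [Group G] [MulAction G X] (μ : PMF G) (f : X → ℝ) : Prop :=
  ∀ x : X, HasSum (fun y : X => f y * transProb μ x y) (f x)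

/-- The action of `G` on `X` is `μ`-Liouville if all bounded `μ`-harmonic functions on `X` are
constant. -/
def IsLiouville {G : Type*} (X : Type*) [Group G] [MulAction G X] (μ : PMF G) : Prop :=
  ∀ f : X → ℝ, (∃ C : ℝ, ∀ x, |f x| ≤ C) → IsHarmonic μ f → ∀ x y, f x = f y

/-- A mean on `G`: a finitely additive probability measure defined on all subsets of `G`. -/
structure IsMean {G : Type*} (m : Set G → ℝ) : Prop where
  nonneg : ∀ A : Set G, 0 ≤ m A
  univ : m Set.univ = 1
  union : ∀ A B : Set G, Disjoint A B → m (A ∪ B) = m A + m B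

/-- The set function `m · x` on `X` given by `(m · x)(A) = m {g | g x ∈ A}`. -/
def push {G X : Type*} [Group G] [MulAction G X] (m : Set G → ℝ) (x : X) : Set X → ℝ :=
  fun A => m {g : G | g • x ∈ A}

/-- `E x`, the family of the points `g x`, `g ∈ E`, counted with multiplicity. -/
def translate {G X : Type*} [Group G] [MulAction G X] (E : Finset G) (x : X) : Multiset X :=
  E.val.map (fun g => g • x)

open Classical in
/-- The cardinality of the symmetric difference of two multisets, i.e. the sum over all `z` of
the absolute difference of the multiplicities of `z` (subtraction of multisets is truncated). -/
noncomputable def symmDiffCard {X : Type*} (s t : Multiset X) : ℕ :=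
  ((s - t) + (t - s)).card

/-- The existence of co-Følner sets for the action of `G` on `X`. -/
def HasCoFolnerSets (G X : Type*) [Group G] [MulAction G X] : Prop :=
  ∀ ε : ℝ, 0 < ε → ∀ F : Finset X, ∃ E : Finset G, E.Nonempty ∧
    ∀ x ∈ F, ∀ y ∈ F, (symmDiffCard (translate E x) (translate E y) : ℝ) ≤ ε * (E.card : ℝ)

end LiouvilleAction

/-!
The implications are proved in a cycle.

A Liouville measure gives a mean. Take the limit, along an ultrafilter, of the Cesàro averages of
the iterates of the Markov operator. Applied to the indicator of `B ⊆ X` it produces a bounded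
harmonic function, hence a constant; evaluated on `G` itself at `1` it is a mean `m`, and the
harmonic function is `x ↦ (m · x)(B)` (`exists_mean_of_isLiouville`).

A mean gives co-Følner sets. The Hahn–Banach theorem provides finitely supported probability
measures `φ` on `G` such that `φ x` and `φ y` are close in `ℓ¹(X)` for all `x`, `y` in a given
finite set `F` (`hasAlmostInvariantMeasures_of_mean`). Passing from `φ` to a set is the delicate point,
since superlevel sets of `φ` need not be almost invariant: the mass `φ` moves to a point of `X` may
come from elements of very different weights. If `G` satisfies the Følner condition, Følner sets of
`G` are co-Følner sets, by transitivity. Otherwise a finite set `K` multiplies the cardinality of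
every finite set `P` by any prescribed factor (`exists_expanding_or_folner`). On the other hand, a
superlevel set `P` of a suitable almost invariant measure moves a prescribed finite set `Q ⊆ X` into
a set of at most `2 |P|` points (`HasAlmostInvariantMeasures.exists_card_smul_le`). With
`Q = K (supp φ) F`, the convolution of the indicator of `P K` with `φ` is an almost invariant
function with values in `[0, 1]`, whose mass `|P K|` is much larger than the number of points of `X` to which
it moves `F`. Rounding it to the indicator of a set changes the number of elements that move `x` to
`z` by about the square root of that number, which is negligible in total
(`HasAlmostInvariantMeasures.hasCoFolnerSets_of_expanding`).

Co-Følner sets give a Liouville measure, by the construction of Kaimanovich and Vershik. If `E` is a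
co-Følner set, the law of `a⁻¹ b` for independent uniform `a`, `b` in `E` is symmetric and almost
invariant. A mixture of such measures, each almost invariant on a ball determined by the preceding
ones, makes bounded harmonic functions constant: within a long time some step uses a late
measure, and the first such step forgets the starting point (`abs_sub_le_of_almost_invariant`,
`exists_isLiouville_of_hasCoFolnerSets`).
-/

namespace LiouvilleAction

open Filter Topology MeasureTheory

/-! ### Averages against a probability measure -/

/-- The expectation of `F` under the probability measure `μ`. -/
noncomputable def avg {α : Type*} (μ : PMF α) (F : α → ℝ) : ℝ :=
  ∑' a, (μ a).toReal * F a

section avg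

variable {α β : Type*}

theorem hasSum_toReal (μ : PMF α) : HasSum (fun a => (μ a).toReal) 1 := by
  have h := ENNReal.hasSum_toReal (f := fun a => μ a) (by rw [μ.tsum_coe]; simp)
  rwa [← ENNReal.tsum_toReal_eq μ.apply_ne_top, μ.tsum_coe, ENNReal.toReal_one] at h

theorem summable_mul_of_bounded (μ : PMF α) {F : α → ℝ} {C : ℝ} (hF : ∀ a, |F a| ≤ C) :
    Summable fun a => (μ a).toReal * F a := by
  refine Summable.of_norm_bounded ((hasSum_toReal μ).summable.mul_right C) fun a => ?_
  rw [Real.norm_eq_abs, abs_mul, abs_of_nonneg ENNReal.toReal_nonneg]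
  exact mul_le_mul_of_nonneg_left (hF a) ENNReal.toReal_nonneg

theorem avg_const (μ : PMF α) (c : ℝ) : avg μ (fun _ => c) = c := by
  simp [avg, tsum_mul_right, (hasSum_toReal μ).tsum_eq]

theorem avg_le_avg (μ : PMF α) {F H : α → ℝ} {C D : ℝ} (hF : ∀ a, |F a| ≤ C)
    (hH : ∀ a, |H a| ≤ D) (h : ∀ a ∈ μ.support, F a ≤ H a) : avg μ F ≤ avg μ H := by
  refine (summable_mul_of_bounded μ hF).tsum_le_tsum (fun a => ?_) (summable_mul_of_bounded μ hH)
  by_cases ha : a ∈ μ.support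
  · exact mul_le_mul_of_nonneg_left (h a ha) ENNReal.toReal_nonneg
  · simp [(μ.apply_eq_zero_iff a).2 ha]

theorem avg_add (μ : PMF α) {F H : α → ℝ} {C D : ℝ} (hF : ∀ a, |F a| ≤ C)
    (hH : ∀ a, |H a| ≤ D) : avg μ (fun a => F a + H a) = avg μ F + avg μ H := by
  simp only [avg, mul_add]
  exact (summable_mul_of_bounded μ hF).tsum_add (summable_mul_of_bounded μ hH)

theorem avg_sub (μ : PMF α) {F H : α → ℝ} {C D : ℝ} (hF : ∀ a, |F a| ≤ C)
    (hH : ∀ a, |H a| ≤ D) : avg μ (fun a => F a - H a) = avg μ F - avg μ H := by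
  simp only [avg, mul_sub]
  exact (summable_mul_of_bounded μ hF).tsum_sub (summable_mul_of_bounded μ hH)

theorem abs_avg_le_avg_abs (μ : PMF α) {F : α → ℝ} {C : ℝ} (hF : ∀ a, |F a| ≤ C) :
    |avg μ F| ≤ avg μ (fun a => |F a|) := by
  have h := (summable_mul_of_bounded μ hF).norm
  have h1 := norm_tsum_le_tsum_norm h
  simpa [avg, abs_mul] using h1

theorem abs_avg_le (μ : PMF α) {F : α → ℝ} {C : ℝ} (hF : ∀ a ∈ μ.support, |F a| ≤ C) :
    |avg μ F| ≤ C := by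
  classical
  have hC : 0 ≤ C := by
    obtain ⟨a, ha⟩ := μ.support_nonempty
    exact (abs_nonneg _).trans (hF a ha)
  have e : avg μ F = avg μ (fun a => if a ∈ μ.support then F a else 0) := by
    refine tsum_congr fun a => ?_
    by_cases ha : a ∈ μ.support
    · simp [ha]
    · simp [(μ.apply_eq_zero_iff a).2 ha]
  have hb : ∀ a, |if a ∈ μ.support then F a else 0| ≤ C := by
    intro a
    split_ifs with ha
    · exact hF a ha
    · simpa using hC
  rw [e]
  refine (abs_avg_le_avg_abs μ hb).trans ?_
  rw [← avg_const μ C]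
  refine avg_le_avg μ (C := C) (D := C) (fun a => ?_) (fun a => ?_) (fun a _ => ?_)
  · rw [abs_abs]; exact hb a
  · rw [abs_of_nonneg hC]
  · exact hb a

theorem avg_bind (p : PMF α) (q : α → PMF β) {F : β → ℝ} {C : ℝ} (hF : ∀ b, |F b| ≤ C) :
    avg (p.bind q) F = avg p fun a => avg (q a) F := by
  have e : ∀ b, ((p.bind q) b).toReal = ∑' a, (p a).toReal * (q a b).toReal := by
    intro b
    have hne : ∀ a, p a * q a b ≠ ⊤ := by
      intro a
      have h1 := p.apply_ne_top a
      have h2 := (q a).apply_ne_top b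
      exact ENNReal.mul_ne_top h1 h2
    rw [PMF.bind_apply, ENNReal.tsum_toReal_eq hne]
    exact tsum_congr fun a => ENNReal.toReal_mul
  have hs : Summable fun x : α × β => (p x.1).toReal * (q x.1 x.2).toReal := by
    have h1 : ∀ a, HasSum (fun b => (p a).toReal * (q a b).toReal) (p a).toReal := fun a => by
      simpa only [mul_one] using (hasSum_toReal (q a)).mul_left (p a).toReal
    refine (summable_prod_of_nonneg fun x => ?_).2 ⟨fun a => (h1 a).summable, ?_⟩
    · exact mul_nonneg ENNReal.toReal_nonneg ENNReal.toReal_nonneg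
    · exact (hasSum_toReal p).summable.congr fun a => (h1 a).tsum_eq.symm
  have hs' : Summable fun x : α × β => (p x.1).toReal * (q x.1 x.2).toReal * F x.2 := by
    refine Summable.of_norm_bounded (hs.mul_right C) fun x => ?_
    rw [Real.norm_eq_abs, abs_mul, abs_of_nonneg
      (mul_nonneg ENNReal.toReal_nonneg ENNReal.toReal_nonneg)]
    exact mul_le_mul_of_nonneg_left (hF _)
      (mul_nonneg ENNReal.toReal_nonneg ENNReal.toReal_nonneg)
  simp only [avg, e, ← tsum_mul_right, ← tsum_mul_left]
  rw [Summable.tsum_comm (f := fun a b => (p a).toReal * (q a b).toReal * F b) hs']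
  simp only [mul_assoc]

theorem avg_pure (a : α) (F : α → ℝ) : avg (PMF.pure a) F = F a := by
  classical
  rw [avg, tsum_eq_single a]
  · simp
  · intro b hb
    simp [PMF.pure_apply_of_ne _ _ hb]

theorem avg_bool (c : PMF Bool) (F : Bool → ℝ) :
    avg c F = (c true).toReal * F true + (c false).toReal * F false := by
  rw [avg, tsum_bool, add_comm]

theorem avg_uniformOfFinset (E : Finset α) (hE : E.Nonempty) (F : α → ℝ) :
    avg (PMF.uniformOfFinset E hE) F = (∑ a ∈ E, F a) / E.card := by
  classical
  rw [avg, tsum_eq_sum (s := E)]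
  · rw [Finset.sum_div]
    refine Finset.sum_congr rfl fun a ha => ?_
    rw [PMF.uniformOfFinset_apply_of_mem hE ha]
    simp [div_eq_inv_mul]
  · intro a ha
    simp [PMF.uniformOfFinset_apply_of_notMem hE ha]

/-- Dominated convergence for averages, along an arbitrary filter. -/
theorem tendsto_avg {ι : Type*} {l : Filter ι} (μ : PMF α) {F : ι → α → ℝ} {H : α → ℝ} {C : ℝ}
    (hF : ∀ i a, |F i a| ≤ C) (h : ∀ a, Tendsto (fun i => F i a) l (𝓝 (H a))) :
    Tendsto (fun i => avg μ (F i)) l (𝓝 (avg μ H)) := by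
  refine tendsto_tsum_of_dominated_convergence
    (bound := fun a => (μ a).toReal * C) ((hasSum_toReal μ).summable.mul_right C)
    (fun a => (h a).const_mul _) (Eventually.of_forall fun i a => ?_)
  rw [Real.norm_eq_abs, abs_mul, abs_of_nonneg ENNReal.toReal_nonneg]
  exact mul_le_mul_of_nonneg_left (hF i a) ENNReal.toReal_nonneg

end avg

section harmonic

variable {G X : Type*} [Group G] [MulAction G X]

theorem hasSum_mul_transProb (μ : PMF G) {f : X → ℝ} {C : ℝ} (hf : ∀ x, |f x| ≤ C) (x : X) :
    HasSum (fun y => f y * transProb μ x y) (avg μ fun g => f (g • x)) := by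
  have h := (summable_mul_of_bounded μ (F := fun g => f (g • x)) fun g => hf _).hasSum
  rw [← (Equiv.sigmaFiberEquiv fun g : G => g • x).hasSum_iff] at h
  refine h.sigma fun y => ?_
  have hs : Summable fun g : {g : G // g • x = y} => (μ (g : G)).toReal :=
    (hasSum_toReal μ).summable.subtype _
  refine (hs.hasSum.mul_left (f y)).congr_fun fun g => ?_
  have hg : (g : G) • x = y := g.2
  simp [Equiv.sigmaFiberEquiv, hg, mul_comm]

theorem isHarmonic_iff_avg (μ : PMF G) {f : X → ℝ} {C : ℝ} (hf : ∀ x, |f x| ≤ C) :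
    IsHarmonic μ f ↔ ∀ x, avg μ (fun g => f (g • x)) = f x := by
  refine forall_congr' fun x => ⟨fun h => (hasSum_mul_transProb μ hf x).unique h, fun h => ?_⟩
  rw [← h]
  exact hasSum_mul_transProb μ hf x

/-! ### Liouville measures give means -/

/-- The Markov operator of the random walk on `X` driven by `μ`. -/
noncomputable def markov (μ : PMF G) (f : X → ℝ) (x : X) : ℝ :=
  avg μ fun g => f (g • x)

theorem abs_markov_iterate_le (μ : PMF G) {f : X → ℝ} {C : ℝ} (hf : ∀ x, |f x| ≤ C) (k : ℕ)
    (x : X) : |(markov μ)^[k] f x| ≤ C := by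
  induction k generalizing x with
  | zero => exact hf x
  | succ k ih =>
    rw [Function.iterate_succ_apply']
    exact abs_avg_le μ fun g _ => ih _

theorem markov_iterate_comp_smul (μ : PMF G) (f : X → ℝ) (x : X) (k : ℕ) (g : G) :
    (markov μ)^[k] (fun h : G => f (h • x)) g = (markov μ)^[k] f (g • x) := by
  induction k generalizing g with
  | zero => rfl
  | succ k ih =>
    rw [Function.iterate_succ_apply', Function.iterate_succ_apply']
    simp only [markov, ih, smul_smul, smul_eq_mul]

/-- The Cesàro averages `(f + P f + ⋯ + P ^ n f) / (n + 1)` for the Markov operator `P`. -/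
noncomputable def cesaro (μ : PMF G) (f : X → ℝ) (n : ℕ) (x : X) : ℝ :=
  (∑ k ∈ Finset.range (n + 1), (markov μ)^[k] f x) / (n + 1)

theorem abs_cesaro_le (μ : PMF G) {f : X → ℝ} {C : ℝ} (hf : ∀ x, |f x| ≤ C) (n : ℕ) (x : X) :
    |cesaro μ f n x| ≤ C := by
  have hn : (0 : ℝ) < n + 1 := by positivity
  rw [cesaro, abs_div, abs_of_pos hn, div_le_iff₀ hn]
  refine (Finset.abs_sum_le_sum_abs _ _).trans ?_
  refine (Finset.sum_le_card_nsmul _ _ C fun k _ => abs_markov_iterate_le μ hf k x).trans ?_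
  simp [mul_comm]

theorem abs_markov_cesaro_sub_le (μ : PMF G) {f : X → ℝ} {C : ℝ} (hf : ∀ x, |f x| ≤ C) (n : ℕ)
    (x : X) : |markov μ (cesaro μ f n) x - cesaro μ f n x| ≤ 2 * C / (n + 1) := by
  have hn : (0 : ℝ) < n + 1 := by positivity
  have e : markov μ (cesaro μ f n) x
      = (∑ k ∈ Finset.range (n + 1), (markov μ)^[k + 1] f x) / (n + 1) := by
    simp only [Function.iterate_succ_apply']
    simp only [markov, cesaro, avg, Finset.sum_div, Finset.mul_sum]
    rw [Summable.tsum_finsetSum fun k _ => ?_]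
    · refine Finset.sum_congr rfl fun k _ => ?_
      rw [← tsum_div_const]
      exact tsum_congr fun g => (mul_div_assoc _ _ _).symm
    · simp only [← mul_div_assoc]
      exact (summable_mul_of_bounded μ fun g => abs_markov_iterate_le μ hf k _).div_const _
  rw [e, cesaro, ← sub_div, ← Finset.sum_sub_distrib,
    Finset.sum_range_sub (fun k => (markov μ)^[k] f x), abs_div, abs_of_pos hn]
  gcongr
  have h1 := abs_le.1 (abs_markov_iterate_le μ hf (n + 1) x)
  have h0 := abs_le.1 (abs_markov_iterate_le μ hf 0 x)
  rw [abs_le]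
  constructor <;> linarith [h1.1, h1.2, h0.1, h0.2]

theorem cesaro_comp_smul (μ : PMF G) (f : X → ℝ) (x : X) (n : ℕ) (g : G) :
    cesaro μ (fun h : G => f (h • x)) n g = cesaro μ f n (g • x) := by
  simp only [cesaro, markov_iterate_comp_smul]

theorem markov_iterate_add (μ : PMF G) {f f' : X → ℝ} {C D : ℝ} (hf : ∀ x, |f x| ≤ C)
    (hf' : ∀ x, |f' x| ≤ D) (k : ℕ) (x : X) :
    (markov μ)^[k] (fun y => f y + f' y) x = (markov μ)^[k] f x + (markov μ)^[k] f' x := by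
  induction k generalizing x with
  | zero => rfl
  | succ k ih =>
    simp only [Function.iterate_succ_apply']
    simp only [markov, ih]
    exact avg_add μ (fun g => abs_markov_iterate_le μ hf k (g • x))
      fun g => abs_markov_iterate_le μ hf' k (g • x)

theorem markov_iterate_nonneg (μ : PMF G) {f : X → ℝ} (hf : ∀ x, 0 ≤ f x) (k : ℕ) (x : X) :
    0 ≤ (markov μ)^[k] f x := by
  induction k generalizing x with
  | zero => exact hf x
  | succ k ih =>
    rw [Function.iterate_succ_apply']
    exact tsum_nonneg fun g => mul_nonneg ENNReal.toReal_nonneg (ih _)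

theorem markov_iterate_one (μ : PMF G) (k : ℕ) (x : X) :
    (markov μ)^[k] (fun _ => (1 : ℝ)) x = 1 := by
  induction k generalizing x with
  | zero => rfl
  | succ k ih =>
    rw [Function.iterate_succ_apply', markov]
    simp only [ih, avg_const]

theorem exists_tendsto_ultrafilter (U : Ultrafilter ℕ) {u : ℕ → ℝ} {C : ℝ}
    (hu : ∀ n, |u n| ≤ C) : ∃ a, Tendsto u U (𝓝 a) := by
  obtain ⟨a, -, ha⟩ := (isCompact_Icc (a := -C) (b := C)).ultrafilter_le_nhds (U.map u)
    (le_principal_iff.2 (mem_map.2 (univ_mem' fun n => abs_le.1 (hu n))))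
  exact ⟨a, ha⟩

theorem abs_indicator_one_le {α : Type*} (A : Set α) (a : α) :
    |A.indicator (fun _ => (1 : ℝ)) a| ≤ 1 := by
  by_cases ha : a ∈ A <;> simp [ha]

/-- The mean of a set `A` is the limit along an ultrafilter of the Cesàro averages of its indicator
at `1`. Its image `(m · x)(B)` is the limit of the Cesàro averages of the indicator of `B` at `x`,
which is a bounded harmonic function of `x`. -/
theorem exists_mean_of_isLiouville (μ : PMF G) (h : IsLiouville X μ) :
    ∃ m : Set G → ℝ, IsMean m ∧ ∀ x y : X, push m x = push m y := by
  classical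
  have hind := fun A : Set G => abs_indicator_one_le A
  have hind' := fun A : Set X => abs_indicator_one_le A
  obtain ⟨U, hU⟩ : ∃ U : Ultrafilter ℕ, (U : Filter ℕ) ≤ atTop :=
    ⟨Ultrafilter.of atTop, Ultrafilter.of_le _⟩
  have hlim : ∀ A : Set G, ∃ a,
      Tendsto (fun n => cesaro μ (A.indicator fun _ => (1 : ℝ)) n (1 : G)) U (𝓝 a) := fun A =>
    exists_tendsto_ultrafilter U fun n => abs_cesaro_le μ (hind A) n 1
  choose m hm using hlim
  have hn : ∀ n : ℕ, (0 : ℝ) < n + 1 := fun n => by positivity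
  refine ⟨m, ⟨fun A => ?_, ?_, fun A B hAB => ?_⟩, fun x y => ?_⟩
  · refine ge_of_tendsto' (hm A) fun n => div_nonneg (Finset.sum_nonneg fun k _ => ?_) (hn n).le
    exact markov_iterate_nonneg μ (fun g => Set.indicator_nonneg (fun _ _ => zero_le_one) g) k 1
  · refine tendsto_nhds_unique (hm Set.univ) (tendsto_const_nhds.congr fun n => ?_)
    simp only [cesaro, Set.indicator_univ, markov_iterate_one]
    simp [(hn n).ne']
  · refine tendsto_nhds_unique (hm (A ∪ B)) (((hm A).add (hm B)).congr fun n => ?_)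
    rw [Set.indicator_union_of_disjoint hAB]
    simp only [cesaro, ← add_div, ← Finset.sum_add_distrib]
    congr 1
    exact Finset.sum_congr rfl fun k _ => (markov_iterate_add μ (hind A) (hind B) k 1).symm
  · funext B
    have hpush : ∀ z : X, Tendsto (fun n => cesaro μ (B.indicator fun _ => (1 : ℝ)) n z) U
        (𝓝 (push m z B)) := by
      intro z
      refine (hm {g : G | g • z ∈ B}).congr fun n => ?_
      have := cesaro_comp_smul μ (B.indicator fun _ => (1 : ℝ)) z n 1
      rw [one_smul] at this
      rw [← this]
      rfl
    have hbd : ∀ z, |push m z B| ≤ 1 := fun z =>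
      le_of_tendsto' (hpush z).abs fun n => abs_cesaro_le μ (hind' B) n z
    refine h (fun z => push m z B) ⟨1, hbd⟩ ((isHarmonic_iff_avg μ hbd).2 fun z => ?_) x y
    have h1 : Tendsto (fun n => markov μ (cesaro μ (B.indicator fun _ => (1 : ℝ)) n) z) U
        (𝓝 (avg μ fun g => push m (g • z) B)) :=
      tendsto_avg μ (fun n g => abs_cesaro_le μ (hind' B) n _) fun g => hpush _
    have h2 : Tendsto (fun n => markov μ (cesaro μ (B.indicator fun _ => (1 : ℝ)) n) z
        - cesaro μ (B.indicator fun _ => (1 : ℝ)) n z) U (𝓝 0) := by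
      refine squeeze_zero_norm (fun n => abs_markov_cesaro_sub_le μ (hind' B) n z) ?_
      refine Tendsto.mono_left ?_ hU
      exact tendsto_const_nhds.div_atTop
        (tendsto_atTop_add_const_right _ _ tendsto_natCast_atTop_atTop)
    have h3 := tendsto_nhds_unique (h1.sub (hpush z)) h2
    linarith

end harmonic

/-! ### Counting symmetric differences -/

section count

variable {G X : Type*} [Group G] [MulAction G X]

open Classical in
theorem count_translate (E : Finset G) (x z : X) :
    (translate E x).count z = (E.filter fun g => g • x = z).card := by
  rw [translate, Multiset.count_map, Finset.card_def, Finset.filter_val]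
  simp only [eq_comm]

open Classical in
theorem symmDiffCard_translate (E : Finset G) (x y : X) (Z : Finset X)
    (hx : ∀ g ∈ E, g • x ∈ Z) (hy : ∀ g ∈ E, g • y ∈ Z) :
    (symmDiffCard (translate E x) (translate E y) : ℝ) =
      ∑ z ∈ Z, |((E.filter fun g => g • x = z).card : ℝ) -
        ((E.filter fun g => g • y = z).card : ℝ)| := by
  have hmem : ∀ w : X, (∀ g ∈ E, g • w ∈ Z) → ∀ a ∈ translate E w, a ∈ Z := by
    intro w hw a ha
    obtain ⟨g, hg, rfl⟩ := Multiset.mem_map.1 ha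
    exact hw g hg
  rw [symmDiffCard, ← Multiset.sum_count_eq_card (s := Z), Nat.cast_sum]
  · refine Finset.sum_congr rfl fun z _ => ?_
    rw [Multiset.count_add, Multiset.count_sub, Multiset.count_sub, count_translate,
      count_translate]
    rcases le_total (E.filter fun g => g • x = z).card (E.filter fun g => g • y = z).card with h | h
    · rw [Nat.sub_eq_zero_of_le h, zero_add, Nat.cast_sub h, abs_sub_comm, abs_of_nonneg]
      exact sub_nonneg.2 (Nat.cast_le.2 h)
    · rw [Nat.sub_eq_zero_of_le h, add_zero, Nat.cast_sub h, abs_of_nonneg]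
      exact sub_nonneg.2 (Nat.cast_le.2 h)
  · intro a ha
    rcases Multiset.mem_add.1 ha with h | h
    · exact hmem x hx a (Multiset.mem_of_le (Multiset.sub_le_self _ _) h)
    · exact hmem y hy a (Multiset.mem_of_le (Multiset.sub_le_self _ _) h)

theorem abs_sum_smul_sub_le (E : Finset G) (x y : X) {f : X → ℝ} {C : ℝ} (hf : ∀ z, |f z| ≤ C) :
    |∑ g ∈ E, f (g • x) - ∑ g ∈ E, f (g • y)| ≤
      C * symmDiffCard (translate E x) (translate E y) := by
  classical
  let Z : Finset X := E.image (fun g => g • x) ∪ E.image (fun g => g • y)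
  have hx : ∀ g ∈ E, g • x ∈ Z := fun g hg =>
    Finset.mem_union_left _ (Finset.mem_image_of_mem _ hg)
  have hy : ∀ g ∈ E, g • y ∈ Z := fun g hg =>
    Finset.mem_union_right _ (Finset.mem_image_of_mem _ hg)
  have key : ∀ w : X, (∀ g ∈ E, g • w ∈ Z) →
      ∑ g ∈ E, f (g • w) = ∑ z ∈ Z, ((E.filter fun g => g • w = z).card : ℝ) * f z := by
    intro w hw
    rw [← Finset.sum_fiberwise_of_maps_to hw]
    refine Finset.sum_congr rfl fun z _ => ?_
    rw [← nsmul_eq_mul, ← Finset.sum_const]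
    exact Finset.sum_congr rfl fun g hg => by rw [(Finset.mem_filter.1 hg).2]
  rw [symmDiffCard_translate E x y Z hx hy, key x hx, key y hy, ← Finset.sum_sub_distrib,
    Finset.mul_sum]
  refine (Finset.abs_sum_le_sum_abs _ _).trans (Finset.sum_le_sum fun z _ => ?_)
  rw [← sub_mul, abs_mul, mul_comm]
  exact mul_le_mul_of_nonneg_right (hf z) (abs_nonneg _)

theorem hasCoFolnerSets_of_subsingleton [Subsingleton X] : HasCoFolnerSets G X := by
  intro ε hε F
  refine ⟨{1}, Finset.singleton_nonempty 1, fun x _ y _ => ?_⟩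
  rw [Subsingleton.elim x y]
  simp [symmDiffCard, hε.le]

end count

/-! ### Co-Følner sets give a Liouville measure -/

section construction

variable {G X : Type*} [Group G] [MulAction G X]

theorem Symmetric.bind {ι : Type*} (p : PMF ι) {q : ι → PMF G} (h : ∀ i, Symmetric (q i)) :
    Symmetric (p.bind q) := fun g => by
  simp only [PMF.bind_apply, h _ g]

/-- The law of `a⁻¹ b` for independent `a`, `b` is symmetric. -/
theorem symmetric_bind_inv_mul (p : PMF G) :
    Symmetric (p.bind fun a => p.bind fun b => PMF.pure (a⁻¹ * b)) := by
  classical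
  intro g
  simp only [PMF.bind_apply, ← ENNReal.tsum_mul_left]
  rw [ENNReal.tsum_comm]
  refine tsum_congr fun b => tsum_congr fun a => ?_
  have : (g⁻¹ = a⁻¹ * b) ↔ (g = b⁻¹ * a) := by
    rw [inv_eq_iff_eq_inv, mul_inv_rev, inv_inv]
  simp only [PMF.pure_apply, this]
  ring

/-- A finitely supported symmetric measure that moves the points of `Q` to nearly the same
distribution and charges a prescribed element: up to a small multiple of the uniform measure on
`{g₀, g₀⁻¹}`, it is the law of `a⁻¹ b` with `a`, `b` uniform in a co-Følner set. -/
theorem exists_symmetric_almost_invariant (h : HasCoFolnerSets G X) {ε : ℝ} (hε : 0 < ε)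
    (Q : Finset X) (g₀ : G) :
    ∃ α : PMF G, Symmetric α ∧ g₀ ∈ α.support ∧ α.support.Finite ∧
      ∀ (f : X → ℝ) (C : ℝ), (∀ z, |f z| ≤ C) → ∀ x ∈ Q, ∀ y ∈ Q,
        |avg α (fun g => f (g • x)) - avg α (fun g => f (g • y))| ≤ C * ε := by
  classical
  obtain ⟨E, hE, hEQ⟩ := h (ε / 2) (by positivity) Q
  have hcard : (0 : ℝ) < E.card := Nat.cast_pos.2 hE.card_pos
  let p := PMF.uniformOfFinset E hE
  let β : PMF G := p.bind fun a => p.bind fun b => PMF.pure (a⁻¹ * b)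
  let γ : PMF G := PMF.uniformOfFinset {g₀, g₀⁻¹} (Finset.insert_nonempty _ _)
  have hγ : Symmetric γ := by
    intro g
    simp only [γ, PMF.uniformOfFinset_apply, Finset.mem_insert, Finset.mem_singleton,
      inv_eq_iff_eq_inv, inv_inv, or_comm]
  obtain ⟨θ, hθ0, hθ1, hθε⟩ : ∃ θ : NNReal, 0 < θ ∧ θ ≤ 1 ∧ (θ : ℝ) ≤ ε / 4 := by
    refine ⟨min 1 (Real.toNNReal (ε / 4)), ?_, min_le_left _ _, ?_⟩
    · exact lt_min one_pos (Real.toNNReal_pos.2 (by positivity))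
    · refine (NNReal.coe_le_coe.2 (min_le_right _ _)).trans_eq ?_
      exact Real.coe_toNNReal _ (by positivity)
  -- A coin that selects `γ` with probability `θ` and `β` otherwise.
  let c : PMF Bool := PMF.ofFintype (fun b => cond b (θ : ENNReal) (1 - θ)) (by
    rw [Fintype.sum_bool]
    exact add_tsub_cancel_of_le (ENNReal.coe_le_one_iff.2 hθ1))
  have hc : (c true).toReal = θ := by simp [c]
  have hc' : (c false).toReal ≤ 1 :=
    ENNReal.toReal_le_of_le_ofReal zero_le_one (by simpa using c.coe_le_one false)
  refine ⟨c.bind fun b => cond b γ β, ?_, ?_, ?_, ?_⟩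
  · refine Symmetric.bind _ fun b => ?_
    cases b
    · exact symmetric_bind_inv_mul p
    · exact hγ
  · refine (PMF.mem_support_bind_iff _ _ _).2 ⟨true, ?_, ?_⟩
    · simp [c, hθ0.ne']
    · simp [γ]
  · have hβf : β.support.Finite := by
      simp only [β, p, PMF.support_bind, PMF.support_uniformOfFinset, PMF.support_pure]
      exact E.finite_toSet.biUnion fun a _ => E.finite_toSet.biUnion fun b _ =>
        Set.finite_singleton _
    have hγf : γ.support.Finite := by
      simp only [γ, PMF.support_uniformOfFinset]
      exact Finset.finite_toSet _
    rw [PMF.support_bind]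
    refine (Set.toFinite c.support).biUnion fun b _ => ?_
    cases b
    · exact hβf
    · exact hγf
  · intro f C hf x hx y hy
    have hC : 0 ≤ C := (abs_nonneg _).trans (hf x)
    have hbd : ∀ (α : PMF G) (z : X), |avg α fun g => f (g • z)| ≤ C := fun α z =>
      abs_avg_le α fun g _ => hf _
    have hb : |avg β (fun g => f (g • x)) - avg β (fun g => f (g • y))| ≤ C * (ε / 2) := by
      have e : ∀ z, avg β (fun g => f (g • z)) =
          avg p fun a => (∑ b ∈ E, f (a⁻¹ • b • z)) / E.card := by
        intro z
        rw [avg_bind p _ fun g => hf (g • z)]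
        congr 1
        funext a
        rw [avg_bind p _ fun g => hf (g • z)]
        simp only [avg_pure, p, avg_uniformOfFinset, mul_smul]
      have hE' : ∀ (z : X) (a : G), |(∑ b ∈ E, f (a⁻¹ • b • z)) / E.card| ≤ C := by
        intro z a
        rw [← avg_uniformOfFinset E hE fun b => f (a⁻¹ • b • z)]
        exact abs_avg_le _ fun b _ => hf _
      rw [e, e, ← avg_sub p (hE' x) (hE' y)]
      refine abs_avg_le p fun a _ => ?_
      rw [← sub_div, abs_div, abs_of_pos hcard, div_le_iff₀ hcard]
      refine (abs_sum_smul_sub_le E x y (f := fun z => f (a⁻¹ • z)) fun z => hf _).trans ?_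
      rw [mul_assoc]
      exact mul_le_mul_of_nonneg_left (hEQ x hx y hy) hC
    have e : ∀ z, avg (c.bind fun b => cond b γ β) (fun g => f (g • z)) =
        (c true).toReal * avg γ (fun g => f (g • z))
          + (c false).toReal * avg β (fun g => f (g • z)) := by
      intro z
      rw [avg_bind c _ fun g => hf (g • z), avg_bool]
      rfl
    have hg : |avg γ (fun g => f (g • x)) - avg γ (fun g => f (g • y))| ≤ 2 * C := by
      have h1 := abs_le.1 (hbd γ x)
      have h2 := abs_le.1 (hbd γ y)
      rw [abs_le]
      constructor <;> linarith [h1.1, h1.2, h2.1, h2.2]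
    rw [e, e, hc]
    calc _ = |(θ : ℝ) * (avg γ (fun g => f (g • x)) - avg γ (fun g => f (g • y))) +
          (c false).toReal * (avg β (fun g => f (g • x)) - avg β (fun g => f (g • y)))| := by
            congr 1; ring
      _ ≤ (θ : ℝ) * (2 * C) + 1 * (C * (ε / 2)) := by
          refine (abs_add_le _ _).trans (add_le_add ?_ ?_)
          · rw [abs_mul, abs_of_nonneg θ.coe_nonneg]
            exact mul_le_mul_of_nonneg_left hg θ.coe_nonneg
          · rw [abs_mul, abs_of_nonneg ENNReal.toReal_nonneg]
            exact mul_le_mul hc' hb (abs_nonneg _) zero_le_one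
      _ ≤ (ε / 4) * (2 * C) + 1 * (C * (ε / 2)) := by gcongr
      _ = C * ε := by ring

theorem exists_pmf_nat_ne_zero : ∃ t : PMF ℕ, ∀ n, t n ≠ 0 := by
  have h : ∑' n : ℕ, (2⁻¹ : ENNReal) ^ n = 2 := ENNReal.tsum_geometric_two
  refine ⟨PMF.normalize (fun n => (2⁻¹ : ENNReal) ^ n) (by rw [h]; simp) (by rw [h]; simp),
    fun n => ?_⟩
  rw [← PMF.mem_support_iff, PMF.mem_support_normalize_iff]
  exact pow_ne_zero n (by simp)

theorem sum_range_toReal_lt_one {t : PMF ℕ} (ht : ∀ n, t n ≠ 0) (n : ℕ) :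
    ∑ i ∈ Finset.range n, (t i).toReal < 1 := by
  have h1 := (hasSum_toReal t).summable.sum_le_tsum (Finset.range (n + 1))
    fun _ _ => ENNReal.toReal_nonneg
  rw [(hasSum_toReal t).tsum_eq, Finset.sum_range_succ] at h1
  have h2 := ENNReal.toReal_pos (ht n) (t.apply_ne_top n)
  linarith

open Pointwise in
open Classical in
/-- Let `s` be the mass of the measures `α i` with `i < n`, all supported in `U`, and let the other
measures move the points of `U ^ (m + 1) x₀` to within `ε` of each other. One step of the
random walk stays among the former with probability `s`, and forgets its position up to `ε`
otherwise; hence the oscillation of a harmonic function is nearly multiplied by `s` when the radius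
of the set decreases by one. -/
theorem abs_sub_le_of_almost_invariant {t : PMF ℕ} {α : ℕ → PMF G} {f : X → ℝ} {C ε : ℝ}
    (hf : ∀ x, |f x| ≤ C) (hε : 0 ≤ ε) (hharm : ∀ x, avg (t.bind α) (fun g => f (g • x)) = f x)
    {n m : ℕ} {U : Finset G} (hU1 : 1 ∈ U) (hU : ∀ i < n, ∀ g ∈ (α i).support, g ∈ U) {x₀ : X}
    (hα : ∀ i, n ≤ i → ∀ u ∈ U ^ (m + 1), ∀ v ∈ U ^ (m + 1),
      |avg (α i) (fun g => f (g • u • x₀)) - avg (α i) (fun g => f (g • v • x₀))| ≤ C * ε)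
    (j k : ℕ) (hjk : k + j ≤ m + 1) (u v : G) (hu : u ∈ U ^ k) (hv : v ∈ U ^ k) :
    |f (u • x₀) - f (v • x₀)| ≤
      (∑ i ∈ Finset.range n, (t i).toReal) ^ j * (2 * C) + C * ε := by
  set s := ∑ i ∈ Finset.range n, (t i).toReal with hs
  have hs0 : 0 ≤ s := Finset.sum_nonneg fun _ _ => ENNReal.toReal_nonneg
  have hC : 0 ≤ C := (abs_nonneg _).trans (hf x₀)
  have hbd : ∀ (β : PMF G) (z : X), |avg β fun g => f (g • z)| ≤ C := fun β z =>
    abs_avg_le β fun g _ => hf _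
  induction j generalizing k u v with
  | zero =>
    have h1 := abs_le.1 (hf (u • x₀))
    have h2 := abs_le.1 (hf (v • x₀))
    have h3 : 0 ≤ C * ε := mul_nonneg hC hε
    rw [pow_zero, one_mul, abs_le]
    constructor <;> linarith [h1.1, h1.2, h2.1, h2.2]
  | succ j ih =>
    set D := s ^ j * (2 * C) with hD
    have hD0 : 0 ≤ D := by positivity
    have hsub : U ^ k ⊆ U ^ (m + 1) := Finset.pow_subset_pow_right hU1 (by omega)
    let d : ℕ → ℝ := fun i =>
      avg (α i) (fun g => f (g • u • x₀)) - avg (α i) (fun g => f (g • v • x₀))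
    have hd : ∀ i, |d i| ≤ C * ε + if i < n then D else 0 := by
      intro i
      split_ifs with hi
      · simp only [d]
        rw [← avg_sub (α i) (fun g => hf (g • u • x₀)) (fun g => hf (g • v • x₀))]
        refine abs_avg_le _ fun g hg => ?_
        rw [smul_smul, smul_smul, add_comm]
        refine ih (k + 1) (by omega) _ _ ?_ ?_
        · rw [pow_succ']; exact Finset.mul_mem_mul (hU i hi g hg) hu
        · rw [pow_succ']; exact Finset.mul_mem_mul (hU i hi g hg) hv
      · rw [add_zero]
        exact hα i (not_lt.1 hi) u (hsub hu) v (hsub hv)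
    have hDb : ∀ i, |if i < n then D else 0| ≤ D := by
      intro i
      split_ifs
      · exact (abs_of_nonneg hD0).le
      · simpa using hD0
    have hb : ∀ i, C * ε + (if i < n then D else 0) ≤ C * ε + D := fun i =>
      add_le_add_right ((le_abs_self _).trans (hDb i)) _
    have hpos : ∀ i, 0 ≤ C * ε + (if i < n then D else 0) := fun i =>
      (abs_nonneg _).trans (hd i)
    have hite : avg t (fun i => if i < n then D else 0) = s * D := by
      rw [avg, tsum_eq_sum (s := Finset.range n), hs, Finset.sum_mul]
      · exact Finset.sum_congr rfl fun i hi => by rw [if_pos (Finset.mem_range.1 hi)]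
      · intro i hi
        rw [if_neg (by simpa using hi), mul_zero]
    have e : f (u • x₀) - f (v • x₀) = avg t d := by
      rw [← hharm (u • x₀), ← hharm (v • x₀), avg_bind t α fun g => hf (g • u • x₀),
        avg_bind t α fun g => hf (g • v • x₀)]
      exact (avg_sub t (fun i => hbd (α i) (u • x₀)) fun i => hbd (α i) (v • x₀)).symm
    rw [e]
    refine (abs_avg_le_avg_abs t fun i => (hd i).trans (hb i)).trans ?_
    refine (avg_le_avg t (C := C * ε + D) (D := C * ε + D) (fun i => ?_) (fun i => ?_)
      fun i _ => hd i).trans ?_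
    · rw [abs_abs]; exact (hd i).trans (hb i)
    · rw [abs_of_nonneg (hpos i)]; exact hb i
    · rw [avg_add t (C := C * ε) (fun _ => (abs_of_nonneg (by positivity)).le) hDb, avg_const,
        hite, hD, pow_succ']
      linarith

open Pointwise in
/-- The measure is a mixture `∑ t n • α n` with all `t n` positive, where `α n` is almost invariant
on a ball whose radius `m n` is so large that `m n` steps of the walk rarely use only the measures
preceding `α n`. -/
theorem exists_isLiouville_of_hasCoFolnerSets [Countable G] [MulAction.IsPretransitive G X]
    [Nonempty X] (h : HasCoFolnerSets G X) :
    ∃ μ : PMF G, NonDegenerate μ ∧ Symmetric μ ∧ IsLiouville X μ := by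
  classical
  obtain ⟨x₀⟩ := ‹Nonempty X›
  obtain ⟨t, ht⟩ := exists_pmf_nat_ne_zero
  obtain ⟨e, he⟩ := exists_surjective_nat G
  let s : ℕ → ℝ := fun n => ∑ i ∈ Finset.range n, (t i).toReal
  have hs0 : ∀ n, 0 ≤ s n := fun n => Finset.sum_nonneg fun _ _ => ENNReal.toReal_nonneg
  have hs1 : ∀ n, s n < 1 := sum_range_toReal_lt_one ht
  have hr : ∀ n : ℕ, (0 : ℝ) < 1 / (n + 1) := fun n => by positivity
  obtain ⟨m, hmono, hm⟩ : ∃ m : ℕ → ℕ, Monotone m ∧ ∀ n, s n ^ m n ≤ 1 / (n + 1) := by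
    choose m hm using fun n => exists_pow_lt_of_lt_one (hr n) (hs1 n)
    -- Partial sums make the sequence monotone.
    refine ⟨fun n => ∑ i ∈ Finset.range (n + 1), m i, fun a b hab => ?_, fun n => ?_⟩
    · exact Finset.sum_le_sum_of_subset (Finset.range_mono (Nat.succ_le_succ hab))
    · refine (pow_le_pow_of_le_one (hs0 n) (hs1 n).le ?_).trans (hm n).le
      exact Finset.single_le_sum (f := m) (fun _ _ => Nat.zero_le _) (Finset.self_mem_range_succ n)
  choose A hAsymm hAe hAfin hA using fun (n : ℕ) (V : Finset G) =>
    exists_symmetric_almost_invariant h (hr n) ((V ^ (m n + 1)).image fun g => g • x₀) (e n)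
  -- `U n` contains the supports of all measures preceding the one chosen at stage `n`.
  let U : ℕ → Finset G := fun n =>
    Nat.rec {1} (fun n V => V ∪ (hAfin n V).toFinset) n
  have hUsucc : ∀ n, U (n + 1) = U n ∪ (hAfin n (U n)).toFinset := fun n => rfl
  have hUmono : Monotone U := monotone_nat_of_le_succ fun n => by
    rw [hUsucc]; exact Finset.subset_union_left
  have hU1 : ∀ n, 1 ∈ U n := fun n => hUmono (Nat.zero_le n) (Finset.mem_singleton_self 1)
  let α : ℕ → PMF G := fun n => A n (U n)
  have hαU : ∀ n, ∀ g ∈ (α n).support, g ∈ U (n + 1) := fun n g hg => by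
    rw [hUsucc]
    exact Finset.mem_union_right _ ((hAfin n (U n)).mem_toFinset.2 hg)
  refine ⟨t.bind α, ?_, Symmetric.bind t fun n => hAsymm n (U n), ?_⟩
  · have hsupp : (t.bind α).support = Set.univ := by
      refine Set.eq_univ_of_forall fun g => ?_
      obtain ⟨n, rfl⟩ := he g
      exact (PMF.mem_support_bind_iff _ _ _).2 ⟨n, ht n, hAe n (U n)⟩
    rw [NonDegenerate, hsupp, Subsemigroup.closure_univ]
  · rintro f ⟨C, hf⟩ hharm x y
    rw [isHarmonic_iff_avg _ hf] at hharm
    have hC : 0 ≤ C := (abs_nonneg _).trans (hf x₀)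
    obtain ⟨g, rfl⟩ := MulAction.exists_smul_eq G x₀ x
    obtain ⟨g', rfl⟩ := MulAction.exists_smul_eq G x₀ y
    obtain ⟨a, rfl⟩ := he g
    obtain ⟨b, rfl⟩ := he g'
    have hle : ∀ᶠ n : ℕ in atTop, |f (e a • x₀) - f (e b • x₀)| ≤ 3 * C * (1 / ((n : ℝ) + 1)) := by
      filter_upwards [eventually_ge_atTop (a + 1), eventually_ge_atTop (b + 1)] with n hna hnb
      have := abs_sub_le_of_almost_invariant hf (hr n).le hharm (n := n) (m := m n) (U := U n)
        (x₀ := x₀) (hU1 n) (fun i hi g hg => hUmono hi (hαU i g hg)) (fun i hi u hu v hv => ?_)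
        (m n) 1 (add_comm _ _).le (e a) (e b)
        (by rw [pow_one]; exact hUmono hna (hαU a _ (hAe a _)))
        (by rw [pow_one]; exact hUmono hnb (hαU b _ (hAe b _)))
      · refine this.trans ?_
        have h1 := mul_le_mul_of_nonneg_right (hm n) (mul_nonneg zero_le_two hC)
        simp only [s] at h1
        linarith
      · have hsub : U n ^ (m n + 1) ⊆ U i ^ (m i + 1) :=
          (Finset.pow_subset_pow_left (hUmono hi)).trans
            (Finset.pow_subset_pow_right (hU1 i) (Nat.succ_le_succ (hmono hi)))
        refine (hA i (U i) f C hf _ (Finset.mem_image_of_mem _ (hsub hu)) _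
          (Finset.mem_image_of_mem _ (hsub hv))).trans ?_
        refine mul_le_mul_of_nonneg_left ?_ hC
        exact one_div_le_one_div_of_le (by positivity) (by exact_mod_cast Nat.succ_le_succ hi)
    have hlim : Tendsto (fun n : ℕ => 3 * C * (1 / ((n : ℝ) + 1))) atTop (𝓝 0) := by
      simpa using (tendsto_one_div_add_atTop_nhds_zero_nat (𝕜 := ℝ)).const_mul (3 * C)
    have h0 := ge_of_tendsto hlim hle
    exact sub_eq_zero.1 (abs_nonpos_iff.1 h0)

end construction

/-! ### Means give almost invariant finitely supported measures -/

section mean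

theorem IsMean.preimage_finset {G J : Type*} [DecidableEq J] {m : Set G → ℝ} (hm : IsMean m)
    (h : G → J) (T : Finset J) : m (h ⁻¹' T) = ∑ j ∈ T, m (h ⁻¹' {j}) := by
  induction T using Finset.induction_on with
  | empty =>
    have := hm.union ∅ ∅ (Set.disjoint_empty _)
    rw [Set.empty_union] at this
    simpa using this
  | insert j T hj ih =>
    rw [Finset.sum_insert hj, ← ih, Finset.coe_insert, Set.insert_eq, Set.preimage_union, hm.union]
    exact Disjoint.preimage h (by simpa using hj)

variable {G X : Type*} [Group G] [MulAction G X]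

/-- The mass that the measure `∑ g ∈ S, φ g • δ_g` moves from `x` to `z`. -/
noncomputable def movedMass (S : Finset G) (φ : G → ℝ) (x z : X) : ℝ :=
  open Classical in ∑ g ∈ S, φ g * if g • x = z then 1 else 0

/-- Integrating `∑ i, (b i (g • x i) - b i (g • y i))` against an invariant mean gives zero, so this
function of `g` is not bounded below by a positive number. Rounding the `b i` down to multiples of
a small `η` reduces the integral to a finite sum. -/
theorem exists_sum_sub_lt {m : Set G → ℝ} (hm : IsMean m)
    (hinv : ∀ x y : X, push m x = push m y) {I : Type*} [Fintype I] (x y : I → X)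
    (b : I → X → ℝ) {C : ℝ} (hb : ∀ i z, |b i z| ≤ C) {u : ℝ} (hu : 0 < u) :
    ∃ g : G, ∑ i, (b i (g • x i) - b i (g • y i)) < u := by
  classical
  by_contra! hcon
  obtain ⟨η, hη, hηu⟩ : ∃ η : ℝ, 0 < η ∧ Fintype.card I * η < u := by
    refine ⟨u / (Fintype.card I + 1), by positivity, ?_⟩
    rw [mul_div_assoc', div_lt_iff₀ (by positivity)]
    nlinarith
  let D : I → X → ℤ := fun i z => ⌊b i z / η⌋
  let h : G → I → ℤ × ℤ := fun g i => (D i (g • x i), D i (g • y i))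
  have hDfin : ∀ i z, D i z ∈ Set.Icc ⌊-C / η⌋ ⌊C / η⌋ := fun i z =>
    ⟨Int.floor_le_floor (by gcongr; exact (abs_le.1 (hb i z)).1),
      Int.floor_le_floor (by gcongr; exact (abs_le.1 (hb i z)).2)⟩
  have hfin : (Set.range h).Finite := by
    refine (Set.Finite.pi' fun _ : I =>
      (Set.finite_Icc ⌊-C / η⌋ ⌊C / η⌋).prod (Set.finite_Icc ⌊-C / η⌋ ⌊C / η⌋)).subset ?_
    rintro _ ⟨g, rfl⟩ i
    exact ⟨hDfin i _, hDfin i _⟩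
  let T := hfin.toFinset
  have hT : ∀ g, h g ∈ T := fun g => hfin.mem_toFinset.2 ⟨g, rfl⟩
  let w : (I → ℤ × ℤ) → ℝ := fun σ => m (h ⁻¹' {σ})
  have hw1 : ∑ σ ∈ T, w σ = 1 := by
    rw [← hm.preimage_finset h T, ← hm.univ]
    congr 1
    exact Set.eq_univ_of_forall hT
  have hmarg : ∀ (c : (I → ℤ × ℤ) → ℤ) (k : ℤ),
      ∑ σ ∈ T with c σ = k, w σ = m {g | c (h g) = k} := by
    intro c k
    rw [← hm.preimage_finset h]
    congr 1
    ext g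
    simp [hT g]
  have hint : ∀ (c : (I → ℤ × ℤ) → ℤ) (K : Finset ℤ), (∀ σ ∈ T, c σ ∈ K) →
      ∑ σ ∈ T, w σ * c σ = ∑ k ∈ K, m {g | c (h g) = k} * k := by
    intro c K hK
    rw [← Finset.sum_fiberwise_of_maps_to hK]
    refine Finset.sum_congr rfl fun k _ => ?_
    rw [← hmarg, Finset.sum_mul]
    exact Finset.sum_congr rfl fun σ hσ => by rw [(Finset.mem_filter.1 hσ).2]
  have heq : ∀ i, ∑ σ ∈ T, w σ * ((σ i).1 : ℝ) = ∑ σ ∈ T, w σ * ((σ i).2 : ℝ) := by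
    intro i
    let K : Finset ℤ := T.image (fun σ => (σ i).1) ∪ T.image fun σ => (σ i).2
    rw [hint (fun σ => (σ i).1) K fun σ hσ =>
        Finset.mem_union_left _ (Finset.mem_image_of_mem _ hσ),
      hint (fun σ => (σ i).2) K fun σ hσ =>
        Finset.mem_union_right _ (Finset.mem_image_of_mem (fun σ => (σ i).2) hσ)]
    refine Finset.sum_congr rfl fun k _ => ?_
    congr 1
    exact congrFun (hinv (x i) (y i)) {z | D i z = k}
  have hzero : ∑ σ ∈ T, w σ * ∑ i, (((σ i).1 : ℝ) - ((σ i).2 : ℝ)) = 0 := by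
    simp only [Finset.mul_sum]
    rw [Finset.sum_comm]
    refine Finset.sum_eq_zero fun i _ => ?_
    simp only [mul_sub, Finset.sum_sub_distrib]
    exact sub_eq_zero.2 (heq i)
  have hpos : ∀ σ ∈ T, 0 < ∑ i, (((σ i).1 : ℝ) - ((σ i).2 : ℝ)) := by
    intro σ hσ
    obtain ⟨g, rfl⟩ := hfin.mem_toFinset.1 hσ
    have h1 : ∑ i, (b i (g • x i) - b i (g • y i)) ≤
        ∑ i, (η * (((h g i).1 : ℝ) - ((h g i).2 : ℝ)) + η) := by
      refine Finset.sum_le_sum fun i _ => ?_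
      have h2 := Int.lt_floor_add_one (b i (g • x i) / η)
      have h3 := Int.floor_le (b i (g • y i) / η)
      rw [div_lt_iff₀ hη] at h2
      rw [le_div_iff₀ hη] at h3
      simp only [h, D]
      linarith
    rw [Finset.sum_add_distrib, ← Finset.mul_sum, Finset.sum_const, Finset.card_univ,
      nsmul_eq_mul] at h1
    have h4 : 0 < η * ∑ i, (((h g i).1 : ℝ) - ((h g i).2 : ℝ)) := by linarith [hcon g]
    exact pos_of_mul_pos_right h4 hη.le
  have hall : ∀ σ ∈ T, w σ = 0 := by
    intro σ hσ
    have h5 := (Finset.sum_eq_zero_iff_of_nonneg fun τ hτ =>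
      mul_nonneg (hm.nonneg (h ⁻¹' {τ})) (hpos τ hτ).le).1 hzero σ hσ
    exact (mul_eq_zero.1 h5).resolve_right (hpos σ hσ).ne'
  rw [Finset.sum_eq_zero hall] at hw1
  exact zero_ne_one hw1

variable (G X) in
/-- Finitely supported probability measures on `G` that move the points of a given finite set to
nearly the same distribution. -/
def HasAlmostInvariantMeasures : Prop :=
  ∀ ε : ℝ, 0 < ε → ∀ F : Finset X, ∃ (S : Finset G) (φ : G → ℝ), (∀ g ∈ S, 0 ≤ φ g) ∧
    ∑ g ∈ S, φ g = 1 ∧ ∀ x ∈ F, ∀ y ∈ F, ∀ Z : Finset X,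
      ∑ z ∈ Z, |movedMass S φ x z - movedMass S φ y z| ≤ ε

/-- By the Hahn–Banach theorem in a finite power of `ℓ¹(X)`: a functional separating `0` from the
vectors `(δ_{g x} - δ_{g y})_{x, y}` would consist of bounded functions on `X`. -/
theorem hasAlmostInvariantMeasures_of_mean {m : Set G → ℝ} (hm : IsMean m)
    (hinv : ∀ x y : X, push m x = push m y) : HasAlmostInvariantMeasures G X := by
  classical
  intro ε hε F
  let I := F × F
  let V := I → lp (fun _ : X => ℝ) 1
  let δ : X → lp (fun _ : X => ℝ) 1 := fun z => lp.single 1 z 1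
  let v : G → V := fun g i => δ (g • (i.1 : X)) - δ (g • (i.2 : X))
  have h0 : (0 : V) ∈ closure (convexHull ℝ (Set.range v)) := by
    by_contra hcon
    obtain ⟨Λ, u, hu0, hu⟩ := geometric_hahn_banach_point_closed
      (convex_convexHull ℝ (Set.range v)).closure isClosed_closure hcon
    rw [map_zero] at hu0
    let b : I → X → ℝ := fun i z => Λ (Pi.single i (δ z))
    have hb : ∀ i z, |b i z| ≤ ‖Λ‖ := by
      intro i z
      refine (Λ.le_opNorm _).trans ?_
      have h1 : ‖(Pi.single i (δ z) : V)‖ ≤ 1 := by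
        refine (pi_norm_le_iff_of_nonneg zero_le_one).2 fun j => ?_
        by_cases hj : j = i
        · subst hj
          rw [Pi.single_eq_same]
          simp [δ, lp.norm_single]
        · rw [Pi.single_eq_of_ne hj, norm_zero]
          exact zero_le_one
      exact mul_le_of_le_one_right (norm_nonneg _) h1
    obtain ⟨g, hg⟩ := exists_sum_sub_lt hm hinv (fun i : I => (i.1 : X)) (fun i : I => (i.2 : X))
      b hb hu0
    have h1 : Λ (v g) = ∑ i, (b i (g • (i.1 : X)) - b i (g • (i.2 : X))) := by
      rw [← Finset.univ_sum_single (v g), map_sum]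
      refine Finset.sum_congr rfl fun i _ => ?_
      rw [Pi.single_sub, map_sub]
    have h2 := hu (v g) (subset_closure (subset_convexHull ℝ _ ⟨g, rfl⟩))
    linarith
  obtain ⟨a, ha, hdist⟩ := Metric.mem_closure_iff.1 h0 ε hε
  rw [convexHull_range_eq_exists_affineCombination] at ha
  obtain ⟨S, φ, hφ0, hφ1, rfl⟩ := ha
  refine ⟨S, φ, hφ0, hφ1, fun x hx y hy Z => ?_⟩
  rw [Finset.affineCombination_eq_linear_combination _ _ _ hφ1, dist_zero_left] at hdist
  have hcoord : ∀ z, (∑ g ∈ S, φ g • v g) (⟨x, hx⟩, ⟨y, hy⟩) z =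
      movedMass S φ x z - movedMass S φ y z := by
    intro z
    rw [Finset.sum_apply, lp.coeFn_sum, Finset.sum_apply, movedMass, movedMass,
      ← Finset.sum_sub_distrib]
    refine Finset.sum_congr rfl fun g _ => ?_
    change φ g * ((Pi.single (g • x) 1 : X → ℝ) z - (Pi.single (g • y) 1 : X → ℝ) z) = _
    simp only [Pi.single_apply, mul_sub, eq_comm]
  have hnorm := (norm_le_pi_norm (∑ g ∈ S, φ g • v g) (⟨x, hx⟩, ⟨y, hy⟩)).trans hdist.le
  have hsum := lp.sum_rpow_le_norm_rpow (p := 1) (by simp)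
    ((∑ g ∈ S, φ g • v g) (⟨x, hx⟩, ⟨y, hy⟩)) Z
  simp only [ENNReal.toReal_one, Real.rpow_one, hcoord, Real.norm_eq_abs] at hsum
  exact hsum.trans hnorm

end mean

/-! ### Layer cake and rounding -/

theorem integrable_sum_indicator_Ioc {α : Type*} (S : Finset α) (a : α → ℝ) :
    Integrable fun τ : ℝ => ∑ i ∈ S, (Set.Ioc 0 (a i)).indicator (fun _ => (1 : ℝ)) τ :=
  integrable_finsetSum _ fun i _ =>
    (integrable_indicator_iff measurableSet_Ioc).2 (integrableOn_const (by simp))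

theorem integral_sum_indicator_Ioc {α : Type*} (S : Finset α) (a : α → ℝ)
    (ha : ∀ i ∈ S, 0 ≤ a i) :
    ∫ τ : ℝ, ∑ i ∈ S, (Set.Ioc 0 (a i)).indicator (fun _ => (1 : ℝ)) τ = ∑ i ∈ S, a i := by
  rw [integral_finsetSum]
  · refine Finset.sum_congr rfl fun i hi => ?_
    rw [integral_indicator measurableSet_Ioc]
    simp [ha i hi]
  · exact fun i _ => (integrable_indicator_iff measurableSet_Ioc).2 (integrableOn_const (by simp))

theorem sum_indicator_Ioc_eq_card {α : Type*} (S : Finset α) (a : α → ℝ) {τ : ℝ} (hτ : 0 < τ) :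
    ∑ i ∈ S, (Set.Ioc 0 (a i)).indicator (fun _ => (1 : ℝ)) τ =
      (S.filter fun i => τ ≤ a i).card := by
  rw [← Finset.sum_boole]
  exact Finset.sum_congr rfl fun i _ => by simp [Set.indicator_apply, hτ]

/-- Integrating the cardinalities of the superlevel sets over the level. -/
theorem exists_card_superlevel_lt {α β : Type*} (S : Finset α) (Z : Finset β) (a : α → ℝ)
    (b : β → ℝ) (ha : ∀ i ∈ S, 0 ≤ a i) (hb : ∀ z ∈ Z, 0 ≤ b z)
    (h : ∑ z ∈ Z, b z < 2 * ∑ i ∈ S, a i) :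
    ∃ τ : ℝ, 0 < τ ∧ (Z.filter fun z => τ ≤ b z).card < 2 * (S.filter fun i => τ ≤ a i).card := by
  by_contra! hcon
  have hle := integral_mono ((integrable_sum_indicator_Ioc S a).const_mul 2)
    (integrable_sum_indicator_Ioc Z b) fun τ => ?_
  · rw [integral_const_mul, integral_sum_indicator_Ioc S a ha,
      integral_sum_indicator_Ioc Z b hb] at hle
    linarith
  · rcases le_or_gt τ 0 with hτ | hτ
    · simp [hτ.not_gt]
    · simp only [sum_indicator_Ioc_eq_card _ _ hτ]
      exact_mod_cast hcon τ hτ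

/-- Rounding a `[0, 1]`-valued function to the indicator of a set. The bound is the variance of the
random set that contains each `g` independently with probability `f g`; it is attained by deciding
on the elements one at a time. -/
theorem exists_subset_sum_sq_le {α ι : Type*} [DecidableEq α] (T : Finset α) (I : Finset ι)
    (v : α → ι → ℝ) (f : α → ℝ) (hf0 : ∀ g ∈ T, 0 ≤ f g) (hf1 : ∀ g ∈ T, f g ≤ 1) :
    ∃ E ⊆ T, ∑ i ∈ I, (∑ g ∈ E, v g i - ∑ g ∈ T, f g * v g i) ^ 2 ≤
      ∑ g ∈ T, f g * ∑ i ∈ I, v g i ^ 2 := by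
  induction T using Finset.induction_on with
  | empty => exact ⟨∅, le_rfl, by simp⟩
  | insert g T hg ih =>
    obtain ⟨E, hET, hE⟩ := ih (fun a ha => hf0 a (Finset.mem_insert_of_mem ha))
      fun a ha => hf1 a (Finset.mem_insert_of_mem ha)
    have h0 := hf0 g (Finset.mem_insert_self g T)
    have h1 := hf1 g (Finset.mem_insert_self g T)
    have hgE : g ∉ E := fun h => hg (hET h)
    let A : ι → ℝ := fun i => ∑ a ∈ E, v a i - ∑ a ∈ T, f a * v a i
    have hid : f g * ∑ i ∈ I, (A i + (1 - f g) * v g i) ^ 2 +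
        (1 - f g) * ∑ i ∈ I, (A i - f g * v g i) ^ 2 =
        ∑ i ∈ I, A i ^ 2 + f g * (1 - f g) * ∑ i ∈ I, v g i ^ 2 := by
      simp only [Finset.mul_sum, ← Finset.sum_add_distrib]
      exact Finset.sum_congr rfl fun i _ => by ring
    have hv : 0 ≤ ∑ i ∈ I, v g i ^ 2 := Finset.sum_nonneg fun i _ => sq_nonneg _
    have hbound : ∑ i ∈ I, A i ^ 2 + f g * (1 - f g) * ∑ i ∈ I, v g i ^ 2 ≤
        ∑ a ∈ insert g T, f a * ∑ i ∈ I, v a i ^ 2 := by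
      rw [Finset.sum_insert hg]
      have h2 : f g * (1 - f g) * ∑ i ∈ I, v g i ^ 2 ≤ f g * ∑ i ∈ I, v g i ^ 2 :=
        mul_le_mul_of_nonneg_right (mul_le_of_le_one_right h0 (by linarith)) hv
      linarith
    rcases le_total (∑ i ∈ I, (A i + (1 - f g) * v g i) ^ 2)
      (∑ i ∈ I, (A i - f g * v g i) ^ 2) with hle | hle
    · refine ⟨insert g E, Finset.insert_subset_insert g hET, le_trans ?_ hbound⟩
      have e : ∑ i ∈ I, (∑ a ∈ insert g E, v a i - ∑ a ∈ insert g T, f a * v a i) ^ 2 =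
          ∑ i ∈ I, (A i + (1 - f g) * v g i) ^ 2 := by
        refine Finset.sum_congr rfl fun i _ => ?_
        rw [Finset.sum_insert hgE, Finset.sum_insert hg]
        simp only [A]
        ring
      rw [e, ← hid]
      nlinarith [mul_le_mul_of_nonneg_left hle (sub_nonneg.2 h1)]
    · refine ⟨E, hET.trans (Finset.subset_insert g T), le_trans ?_ hbound⟩
      have e : ∑ i ∈ I, (∑ a ∈ E, v a i - ∑ a ∈ insert g T, f a * v a i) ^ 2 =
          ∑ i ∈ I, (A i - f g * v g i) ^ 2 := by
        refine Finset.sum_congr rfl fun i _ => ?_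
        rw [Finset.sum_insert hg]
        simp only [A]
        ring
      rw [e, ← hid]
      nlinarith [mul_le_mul_of_nonneg_left hle h0]

/-! ### Almost invariant measures give co-Følner sets -/

section folner

variable {G X : Type*} [Group G] [MulAction G X]

theorem movedMass_nonneg {S : Finset G} {φ : G → ℝ} (hφ : ∀ g ∈ S, 0 ≤ φ g) (x z : X) :
    0 ≤ movedMass S φ x z :=
  Finset.sum_nonneg fun g hg => mul_nonneg (hφ g hg) (by split_ifs <;> simp)

theorem sum_movedMass (S : Finset G) (φ : G → ℝ) (x : X) (Z : Finset X)
    (hZ : ∀ g ∈ S, g • x ∈ Z) : ∑ z ∈ Z, movedMass S φ x z = ∑ g ∈ S, φ g := by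
  simp only [movedMass]
  rw [Finset.sum_comm]
  refine Finset.sum_congr rfl fun g hg => ?_
  rw [Finset.sum_eq_single (g • x) (fun z _ hz => by rw [if_neg hz.symm, mul_zero])
    fun h => (h (hZ g hg)).elim, if_pos rfl, mul_one]

theorem le_movedMass {S : Finset G} {φ : G → ℝ} (hφ : ∀ g ∈ S, 0 ≤ φ g) (x : X) {g : G}
    (hg : g ∈ S) : φ g ≤ movedMass S φ x (g • x) := by
  classical
  have := Finset.single_le_sum (f := fun h => φ h * if h • x = g • x then (1 : ℝ) else 0)
    (fun h hh => mul_nonneg (hφ h hh) (by split_ifs <;> simp)) hg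
  simpa [movedMass] using this

open Classical in
theorem movedMass_one (E : Finset G) (x z : X) :
    movedMass E (fun _ => 1) x z = (E.filter fun g => g • x = z).card := by
  simp [movedMass]

open Pointwise in
open Classical in
/-- The set `P` is a superlevel set of an almost invariant measure `φ`: the points `g y`, `g ∈ P`,
lie in the superlevel sets of the measures `φ y`, which almost coincide. -/
theorem HasAlmostInvariantMeasures.exists_card_smul_le (h : HasAlmostInvariantMeasures G X)
    (Q : Finset X) : ∃ P : Finset G, P.Nonempty ∧ (P • Q).card ≤ 2 * P.card := by
  rcases Q.eq_empty_or_nonempty with rfl | ⟨y₀, hy₀⟩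
  · exact ⟨{1}, Finset.singleton_nonempty 1, by simp⟩
  obtain ⟨S, φ, hφ0, hφ1, hφ⟩ := h (1 / (Q.card + 1)) (by positivity) Q
  let b : X → ℝ := fun z =>
    movedMass S φ y₀ z + ∑ y ∈ Q, |movedMass S φ y z - movedMass S φ y₀ z|
  have hb0 : ∀ z, 0 ≤ b z := fun z =>
    add_nonneg (movedMass_nonneg hφ0 _ _) (Finset.sum_nonneg fun _ _ => abs_nonneg _)
  have hby : ∀ y ∈ Q, ∀ z, movedMass S φ y z ≤ b z := by
    intro y hy z
    have h1 := Finset.single_le_sum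
      (f := fun y => |movedMass S φ y z - movedMass S φ y₀ z|) (fun _ _ => abs_nonneg _) hy
    have h2 := le_abs_self (movedMass S φ y z - movedMass S φ y₀ z)
    simp only [b]
    linarith
  have hsum : ∑ z ∈ S • Q, b z < 2 * ∑ g ∈ S, φ g := by
    simp only [b]
    rw [Finset.sum_add_distrib, sum_movedMass S φ y₀ _ fun g hg => Finset.smul_mem_smul hg hy₀,
      Finset.sum_comm, hφ1]
    have h1 : ∑ y ∈ Q, ∑ z ∈ S • Q, |movedMass S φ y z - movedMass S φ y₀ z| ≤
        Q.card • (1 / ((Q.card : ℝ) + 1)) :=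
      Finset.sum_le_card_nsmul _ _ _ fun y hy => hφ y hy y₀ hy₀ _
    have h2 : (Q.card : ℝ) * (1 / (Q.card + 1)) < 1 := by
      rw [mul_one_div, div_lt_one (by positivity)]
      linarith
    rw [nsmul_eq_mul] at h1
    linarith
  -- `b` dominates all `φ y`, `y ∈ Q`, and its mass is less than twice that of `φ`.
  obtain ⟨τ, -, hτ⟩ := exists_card_superlevel_lt S (S • Q) φ b hφ0 (fun z _ => hb0 z) hsum
  refine ⟨S.filter fun g => τ ≤ φ g, Finset.card_pos.1 (by omega), le_trans ?_ hτ.le⟩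
  refine Finset.card_le_card fun z hz => ?_
  obtain ⟨g, hg, y, hy, rfl⟩ := Finset.mem_smul.1 hz
  obtain ⟨hgS, hgτ⟩ := Finset.mem_filter.1 hg
  exact Finset.mem_filter.2 ⟨Finset.smul_mem_smul hgS hy,
    hgτ.trans ((le_movedMass hφ0 y hgS).trans (hby y hy _))⟩

open Pointwise in
open Classical in
/-- If the Følner condition fails, then finite sets can be expanded by any factor by multiplying
on the right with a fixed finite set. -/
theorem exists_expanding_or_folner (G : Type*) [Group G] :
    (∀ (δ : ℝ) (K : Finset G), 0 < δ → ∃ E : Finset G, E.Nonempty ∧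
        ((E * K).card : ℝ) ≤ (1 + δ) * E.card) ∨
      ∀ N : ℝ, ∃ K : Finset G, ∀ P : Finset G, P.Nonempty → N * P.card ≤ (P * K).card := by
  by_contra! hcon
  obtain ⟨⟨δ, K, hδ, hK⟩, N, hN⟩ := hcon
  have hKn : K.Nonempty := by
    by_contra hK0
    have := hK {1} (Finset.singleton_nonempty 1)
    rw [Finset.not_nonempty_iff_eq_empty.1 hK0] at this
    simp at this
    linarith
  have hpow : ∀ (j : ℕ) (P : Finset G), P.Nonempty →
      (1 + δ) ^ j * P.card ≤ ((P * K ^ j).card : ℝ) := by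
    intro j P hP
    induction j with
    | zero => simp
    | succ j ih =>
      rw [pow_succ K, ← mul_assoc, pow_succ', mul_assoc]
      exact (mul_le_mul_of_nonneg_left ih (by linarith)).trans
        (hK (P * K ^ j) (hP.mul (hKn.pow))).le
  obtain ⟨j, hj⟩ := pow_unbounded_of_one_lt N (by linarith : 1 < 1 + δ)
  obtain ⟨P, hP, hPN⟩ := hN (K ^ j)
  have h1 := hpow j P hP
  have h2 : N * P.card ≤ (1 + δ) ^ j * P.card :=
    mul_le_mul_of_nonneg_right hj.le (Nat.cast_nonneg _)
  linarith

open Pointwise in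
open Classical in
theorem hasCoFolnerSets_of_folner [MulAction.IsPretransitive G X]
    (h : ∀ (δ : ℝ) (K : Finset G), 0 < δ → ∃ E : Finset G, E.Nonempty ∧
        ((E * K).card : ℝ) ≤ (1 + δ) * E.card) : HasCoFolnerSets G X := by
  intro ε hε F
  rcases isEmpty_or_nonempty X with hX | ⟨⟨x₀⟩⟩
  · exact ⟨{1}, Finset.singleton_nonempty 1, fun x => (hX.false x).elim⟩
  choose k hk using MulAction.exists_smul_eq G x₀
  obtain ⟨E, hE, hEK⟩ := h (ε / 4) (insert 1 (F.image k)) (by positivity)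
  refine ⟨E, hE, fun x hx y hy => ?_⟩
  set W := E * insert 1 (F.image k) with hW
  have hEW : E ⊆ W := fun g hg =>
    Finset.mem_mul.2 ⟨g, hg, 1, Finset.mem_insert_self _ _, mul_one g⟩
  have hsub : ∀ x ∈ F, ∀ g ∈ E, g * k x ∈ W := fun x hx g hg =>
    Finset.mul_mem_mul hg (Finset.mem_insert_of_mem (Finset.mem_image_of_mem k hx))
  -- All families `E x`, `x ∈ F`, are contained in `W x₀`, which is only slightly larger.
  have hmiss : ∀ x ∈ F, ∀ z, (E.filter fun g => g • x = z).card ≤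
      (W.filter fun g => g • x₀ = z).card := by
    intro x hx z
    refine Finset.card_le_card_of_injOn (fun g => g * k x) (fun g hg => ?_)
      fun a _ b _ hab => mul_right_cancel hab
    obtain ⟨h1, h2⟩ := Finset.mem_filter.1 hg
    refine Finset.mem_coe.2 (Finset.mem_filter.2 ⟨hsub x hx g h1, ?_⟩)
    rw [mul_smul, hk, h2]
  let Z : Finset X := W • {x₀}
  have hWZ : ∀ g ∈ W, g • x₀ ∈ Z := fun g hg =>
    Finset.smul_mem_smul hg (Finset.mem_singleton_self x₀)
  have hEZ : ∀ x ∈ F, ∀ g ∈ E, g • x ∈ Z := by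
    intro x hx g hg
    have := hWZ _ (hsub x hx g hg)
    rwa [mul_smul, hk] at this
  have hcW := Finset.card_eq_sum_card_fiberwise hWZ
  have hcE : ∀ x ∈ F, E.card = _ := fun x hx =>
    Finset.card_eq_sum_card_fiberwise (hEZ x hx)
  rw [symmDiffCard_translate E x y Z (hEZ x hx) (hEZ y hy)]
  have hterm : ∀ z ∈ Z, |((E.filter fun g => g • x = z).card : ℝ) -
      ((E.filter fun g => g • y = z).card : ℝ)| ≤
      2 * (W.filter fun g => g • x₀ = z).card - (E.filter fun g => g • x = z).card -
        (E.filter fun g => g • y = z).card := by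
    intro z _
    have h1 : ((E.filter fun g => g • x = z).card : ℝ) ≤ (W.filter fun g => g • x₀ = z).card :=
      Nat.cast_le.2 (hmiss x hx z)
    have h2 : ((E.filter fun g => g • y = z).card : ℝ) ≤ (W.filter fun g => g • x₀ = z).card :=
      Nat.cast_le.2 (hmiss y hy z)
    rw [abs_le]
    constructor <;> linarith
  refine (Finset.sum_le_sum hterm).trans ?_
  rw [Finset.sum_sub_distrib, Finset.sum_sub_distrib, ← Finset.mul_sum, ← Nat.cast_sum,
    ← Nat.cast_sum, ← Nat.cast_sum, ← hcW, ← hcE x hx, ← hcE y hy]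
  have : (0 : ℝ) ≤ ε * E.card := by positivity
  linarith

end folner

/-! ### Rounding an almost invariant function to a set -/

section expanding

variable {G X : Type*} [Group G] [MulAction G X]

open Classical in
/-- The density of the convolution of the counting measure on `D` with `∑ s ∈ S, φ s • δ_s`. -/
noncomputable def countConv (D S : Finset G) (φ : G → ℝ) (g : G) : ℝ :=
  ∑ h ∈ D, ∑ s ∈ S, φ s * if h * s = g then 1 else 0

theorem countConv_nonneg (D : Finset G) {S : Finset G} {φ : G → ℝ} (hφ : ∀ g ∈ S, 0 ≤ φ g)
    (g : G) : 0 ≤ countConv D S φ g :=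
  Finset.sum_nonneg fun _ _ => Finset.sum_nonneg fun s hs =>
    mul_nonneg (hφ s hs) (by split_ifs <;> simp)

theorem countConv_le (D : Finset G) {S : Finset G} {φ : G → ℝ} (hφ : ∀ g ∈ S, 0 ≤ φ g)
    (g : G) : countConv D S φ g ≤ ∑ s ∈ S, φ s := by
  classical
  rw [countConv, Finset.sum_comm]
  refine Finset.sum_le_sum fun s hs => ?_
  rw [← Finset.mul_sum]
  refine mul_le_of_le_one_right (hφ s hs) ?_
  rw [Finset.sum_boole]
  refine Nat.cast_le_one.2 (Finset.card_le_one.2 fun a ha b hb => ?_)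
  rw [Finset.mem_filter] at ha hb
  exact mul_right_cancel (ha.2.trans hb.2.symm)

open Pointwise in
open Classical in
theorem sum_countConv_mul (D S : Finset G) (φ : G → ℝ) (F : G → ℝ) :
    ∑ g ∈ D * S, countConv D S φ g * F g = ∑ h ∈ D, ∑ s ∈ S, φ s * F (h * s) := by
  simp only [countConv, Finset.sum_mul]
  rw [Finset.sum_comm]
  refine Finset.sum_congr rfl fun h hh => ?_
  rw [Finset.sum_comm]
  refine Finset.sum_congr rfl fun s hs => ?_
  simp only [mul_assoc, ← Finset.mul_sum, ite_mul, one_mul, zero_mul]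
  rw [Finset.sum_ite_eq, if_pos (Finset.mul_mem_mul hh hs)]

open Pointwise in
open Classical in
theorem movedMass_countConv (D S : Finset G) (φ : G → ℝ) (x z : X) :
    movedMass (D * S) (countConv D S φ) x z = ∑ h ∈ D, movedMass S φ x (h⁻¹ • z) := by
  rw [movedMass, sum_countConv_mul D S φ fun g => if g • x = z then 1 else 0]
  simp only [movedMass, mul_smul, eq_inv_smul_iff]

open Pointwise in
open Classical in
/-- Let `φ` be almost invariant on `F`, with support `S`, and let `K` expand by a large factor `N`.
Choose `P` such that the set of points `P K S F` has at most `2 |P|` elements, and put `D = P K`.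
The convolution of the indicator of `D` with `φ` takes values in `[0, 1]`, is almost
invariant and has mass `|D| ≥ N |P|`, which is much larger than the number of points on which its
translates live; so the error made by rounding it to the indicator of a set `E` is relatively
small. -/
theorem HasAlmostInvariantMeasures.hasCoFolnerSets_of_expanding
    (h : HasAlmostInvariantMeasures G X)
    (hexp : ∀ N : ℝ, ∃ K : Finset G, ∀ P : Finset G, P.Nonempty → N * P.card ≤ (P * K).card) :
    HasCoFolnerSets G X := by
  intro ε hε F
  rcases F.eq_empty_or_nonempty with rfl | ⟨x₁, hx₁⟩
  · exact ⟨{1}, Finset.singleton_nonempty 1, by simp⟩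
  obtain ⟨θ, hθ0, hθ1, hθε⟩ : ∃ θ : ℝ, 0 < θ ∧ θ ≤ 1 / 2 ∧ θ ≤ ε / 16 :=
    ⟨min (1 / 2) (ε / 16), by positivity, min_le_left _ _, min_le_right _ _⟩
  obtain ⟨S, φ, hφ0, hφ1, hφ⟩ := h (ε / 4) (by positivity) F
  -- `N` makes the Cauchy–Schwarz bound `2 |F| ^ 2 |P| |D|` at most `(θ |D|) ^ 2`.
  set N : ℝ := 2 * F.card ^ 2 / θ ^ 2 with hN
  obtain ⟨K, hK⟩ := hexp N
  obtain ⟨P, hP, hPQ⟩ := h.exists_card_smul_le (K • S • F)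
  set D := P * K with hD
  have hND : N * P.card ≤ (D.card : ℝ) := hK P hP
  have hFpos : (0 : ℝ) < F.card := Nat.cast_pos.2 (Finset.card_pos.2 ⟨x₁, hx₁⟩)
  have hPpos : (0 : ℝ) < P.card := Nat.cast_pos.2 hP.card_pos
  have hDpos : (0 : ℝ) < D.card := lt_of_lt_of_le (by positivity) hND
  set T := D * S with hT
  set f := countConv D S φ with hf
  set Z := T • F with hZ
  have hZcard : (Z.card : ℝ) ≤ 2 * P.card := by
    have : Z = P • K • S • F := by
      rw [hZ, hT, hD, mul_assoc, mul_smul, mul_smul]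
    rw [this]
    exact_mod_cast hPQ
  have hTZ : ∀ x ∈ F, ∀ g ∈ T, g • x ∈ Z := fun x hx g hg => Finset.smul_mem_smul hg hx
  have hmass : ∑ g ∈ T, f g = D.card := by
    have := sum_countConv_mul D S φ fun _ => 1
    simpa [hφ1] using this
  obtain ⟨E, hET, hE⟩ := exists_subset_sum_sq_le T (F ×ˢ Z)
    (fun g i => if g • i.1 = i.2 then 1 else 0) f (fun g _ => countConv_nonneg D hφ0 g)
    fun g _ => (countConv_le D hφ0 g).trans hφ1.le
  let err : X → X → ℝ := fun x z => |movedMass E (fun _ => 1) x z - movedMass T f x z|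
  have hsq : ∑ i ∈ F ×ˢ Z, err i.1 i.2 ^ 2 ≤ F.card * D.card := by
    calc ∑ i ∈ F ×ˢ Z, err i.1 i.2 ^ 2
        ≤ ∑ g ∈ T, f g * ∑ i ∈ F ×ˢ Z, (if g • i.1 = i.2 then (1 : ℝ) else 0) ^ 2 := by
          refine le_of_eq_of_le (Finset.sum_congr rfl fun i _ => ?_) hE
          simp [err, movedMass]
      _ = ∑ g ∈ T, f g * F.card := by
          refine Finset.sum_congr rfl fun g hg => ?_
          rw [Finset.sum_product]
          congr 1
          rw [Finset.sum_congr rfl fun x hx => ?_, Finset.sum_const, nsmul_eq_mul, mul_one]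
          simp [hTZ x hx g hg]
      _ = F.card * D.card := by rw [← Finset.sum_mul, hmass, mul_comm]
  have herr : ∑ i ∈ F ×ˢ Z, err i.1 i.2 ≤ θ * D.card := by
    refine abs_le_of_sq_le_sq' ?_ (by positivity) |>.2
    refine sq_sum_le_card_mul_sum_sq.trans ?_
    rw [Finset.card_product, Nat.cast_mul]
    calc (F.card : ℝ) * Z.card * ∑ i ∈ F ×ˢ Z, err i.1 i.2 ^ 2
        ≤ F.card * (2 * P.card) * (F.card * D.card) := by gcongr
      _ = θ ^ 2 * (N * P.card) * D.card := by
          rw [hN]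
          field_simp
      _ ≤ θ ^ 2 * D.card * D.card := by gcongr
      _ = (θ * D.card) ^ 2 := by ring
  have herrx : ∀ x ∈ F, ∑ z ∈ Z, err x z ≤ θ * D.card := by
    intro x hx
    refine le_trans ?_ herr
    rw [Finset.sum_product]
    exact Finset.single_le_sum (f := fun x => ∑ z ∈ Z, err x z)
      (fun _ _ => Finset.sum_nonneg fun _ _ => abs_nonneg _) hx
  have hEcard : (1 - θ) * D.card ≤ (E.card : ℝ) := by
    have h1 : ∑ z ∈ Z, (movedMass T f x₁ z - movedMass E (fun _ => 1) x₁ z) ≤ θ * D.card :=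
      (Finset.sum_le_sum fun z _ => (le_abs_self _).trans (abs_sub_comm _ _).le).trans
        (herrx x₁ hx₁)
    rw [Finset.sum_sub_distrib, sum_movedMass T f x₁ Z (hTZ x₁ hx₁),
      sum_movedMass E _ x₁ Z (fun g hg => hTZ x₁ hx₁ g (hET hg)), hmass] at h1
    simp only [Finset.sum_const, nsmul_eq_mul, mul_one] at h1
    linarith
  have hinv : ∀ x ∈ F, ∀ y ∈ F,
      ∑ z ∈ Z, |movedMass T f x z - movedMass T f y z| ≤ D.card * (ε / 4) := by
    intro x hx y hy
    calc ∑ z ∈ Z, |movedMass T f x z - movedMass T f y z|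
        ≤ ∑ z ∈ Z, ∑ h ∈ D, |movedMass S φ x (h⁻¹ • z) - movedMass S φ y (h⁻¹ • z)| := by
          refine Finset.sum_le_sum fun z _ => ?_
          rw [hf, hT, movedMass_countConv, movedMass_countConv, ← Finset.sum_sub_distrib]
          exact Finset.abs_sum_le_sum_abs _ _
      _ = ∑ h ∈ D, ∑ z ∈ Z.image (fun z => h⁻¹ • z),
            |movedMass S φ x z - movedMass S φ y z| := by
          rw [Finset.sum_comm]
          refine Finset.sum_congr rfl fun h _ => ?_
          rw [Finset.sum_image fun _ _ _ _ hab => MulAction.injective h⁻¹ hab]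
      _ ≤ D.card • (ε / 4) := Finset.sum_le_card_nsmul _ _ _ fun h _ => hφ x hx y hy _
      _ = D.card * (ε / 4) := nsmul_eq_mul _ _
  have hEpos : (0 : ℝ) < E.card := lt_of_lt_of_le (by nlinarith) hEcard
  refine ⟨E, Finset.card_pos.1 (Nat.cast_pos.1 hEpos), fun x hx y hy => ?_⟩
  rw [symmDiffCard_translate E x y Z (fun g hg => hTZ x hx g (hET hg))
    fun g hg => hTZ y hy g (hET hg)]
  calc _ ≤ ∑ z ∈ Z, (err x z + |movedMass T f x z - movedMass T f y z| + err y z) := by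
        refine Finset.sum_le_sum fun z _ => ?_
        rw [← movedMass_one, ← movedMass_one]
        simp only [err]
        rw [abs_sub_comm (movedMass E _ y z)]
        exact (abs_sub_le _ (movedMass T f y z) _).trans
          (add_le_add_left (abs_sub_le _ (movedMass T f x z) _) _)
    _ ≤ θ * D.card + D.card * (ε / 4) + θ * D.card := by
        rw [Finset.sum_add_distrib, Finset.sum_add_distrib]
        exact add_le_add (add_le_add (herrx x hx) (hinv x hx y hy)) (herrx y hy)
    _ ≤ ε * ((1 - θ) * D.card) := by
        have h1 : 2 * θ + ε / 4 ≤ ε * (1 - θ) := by nlinarith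
        nlinarith
    _ ≤ ε * E.card := by gcongr

end expanding
end LiouvilleAction

theorem mainTheorem1 {G X : Type*} [Group G] [Countable G] [MulAction G X]
    [MulAction.IsPretransitive G X] :
    List.TFAE [
      ∃ μ : PMF G, LiouvilleAction.NonDegenerate μ ∧ LiouvilleAction.Symmetric μ ∧
        LiouvilleAction.IsLiouville X μ,
      ∃ m : Set G → ℝ, LiouvilleAction.IsMean m ∧
        ∀ x y : X, LiouvilleAction.push m x = LiouvilleAction.push m y,
      LiouvilleAction.HasCoFolnerSets G X] := by
  tfae_have 1 → 2 := by
    rintro ⟨μ, -, -, hμ⟩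
    exact LiouvilleAction.exists_mean_of_isLiouville μ hμ
  tfae_have 2 → 3 := by
    rintro ⟨m, hm, hinv⟩
    rcases LiouvilleAction.exists_expanding_or_folner G with h | h
    · exact LiouvilleAction.hasCoFolnerSets_of_folner h
    · exact (LiouvilleAction.hasAlmostInvariantMeasures_of_mean hm
        hinv).hasCoFolnerSets_of_expanding h
  tfae_have 3 → 1 := by
    intro h
    rcases isEmpty_or_nonempty X with hX | hX
    -- On the empty set every measure is Liouville; the action on a point supplies one that is
    -- symmetric and non-degenerate.
    · have : MulAction.IsPretransitive G PUnit.{1} := ⟨fun _ _ => ⟨1, rfl⟩⟩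
      obtain ⟨μ, h1, h2, -⟩ := LiouvilleAction.exists_isLiouville_of_hasCoFolnerSets
        (LiouvilleAction.hasCoFolnerSets_of_subsingleton (G := G) (X := PUnit.{1}))
      exact ⟨μ, h1, h2, fun _ _ _ x => (hX.false x).elim⟩
    · exact LiouvilleAction.exists_isLiouville_of_hasCoFolnerSets h
  tfae_finish
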